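/- Let $k$ be an algebraically closed field, let $B$ and $C$ be finite dimensional associative unital $k$-algebras, let $M$ be a finitely generated $C$-$B$-bimodule (with $k$ acting centrally), and let $A=\begin{bmatrix} B & 0\\ M & C\end{bmatrix}$ be the corresponding triangular matrix algebra. Write $\operatorname{id}$ and $\operatorname{pd}$ for the injective and the projective dimension of a module (possibly $\infty$), where the zero module is given projective dimension $0$; a subscript on the right (left) of a module says that it is considered as a right (left) module. Then the following hold. (i) $\operatorname{id}(B_B)\le \operatorname{id}(A_A)$ and $\operatorname{id}({}_CC)\le \operatorname{id}({}_AA)$. (ii) If $\operatorname{pd}(M_B)<\infty$, then $\operatorname{id}(A_A)\le \max\{\operatorname{id}(B_B)+\operatorname{pd}({}_CM)+1,\ \operatorname{id}(C_C)\}$. (iii) If $\operatorname{pd}({}_CM)<\infty$, then $\operatorname{id}({}_AA)\le \max\{\operatorname{id}({}_CC)+\operatorname{pd}(M_B)+1,\ \operatorname{id}({}_BB)\}$. -/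

import Mathlib

open MulOpposite (op)

universe u v

/-- The underlying type of the lower triangular matrix ring with rows `(B, 0)` and `(M, C)`: the
element `⟨b, m, c⟩` is the matrix with first row `(b, 0)` and second row `(m, c)`. -/
@[ext]
structure TriMat (B C M : Type u) : Type u where
  /-- The upper left entry. -/
  b : B
  /-- The lower left entry. -/
  m : M
  /-- The lower right entry. -/
  c : C

namespace TriMat

variable {B C M : Type u} [Ring B] [Ring C] [AddCommGroup M]

instance : Zero (TriMat B C M) := ⟨⟨0, 0, 0⟩⟩
instance : One (TriMat B C M) := ⟨⟨1, 0, 1⟩⟩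
instance : Add (TriMat B C M) := ⟨fun x y => ⟨x.b + y.b, x.m + y.m, x.c + y.c⟩⟩
instance : Neg (TriMat B C M) := ⟨fun x => ⟨-x.b, -x.m, -x.c⟩⟩

@[simp] lemma zero_b : (0 : TriMat B C M).b = 0 := rfl
@[simp] lemma zero_m : (0 : TriMat B C M).m = 0 := rfl
@[simp] lemma zero_c : (0 : TriMat B C M).c = 0 := rfl
@[simp] lemma one_b : (1 : TriMat B C M).b = 1 := rfl
@[simp] lemma one_m : (1 : TriMat B C M).m = 0 := rfl
@[simp] lemma one_c : (1 : TriMat B C M).c = 1 := rfl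
@[simp] lemma add_b (x y : TriMat B C M) : (x + y).b = x.b + y.b := rfl
@[simp] lemma add_m (x y : TriMat B C M) : (x + y).m = x.m + y.m := rfl
@[simp] lemma add_c (x y : TriMat B C M) : (x + y).c = x.c + y.c := rfl
@[simp] lemma neg_b (x : TriMat B C M) : (-x).b = -x.b := rfl
@[simp] lemma neg_m (x : TriMat B C M) : (-x).m = -x.m := rfl
@[simp] lemma neg_c (x : TriMat B C M) : (-x).c = -x.c := rfl

instance : AddCommGroup (TriMat B C M) where
  add_assoc x y z := by ext <;> simp [add_assoc]
  zero_add x := by ext <;> simp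
  add_zero x := by ext <;> simp
  add_comm x y := by ext <;> simp [add_comm]
  neg_add_cancel x := by ext <;> simp
  nsmul := nsmulRec
  zsmul := zsmulRec

variable [Module C M] [Module Bᵐᵒᵖ M]

/-- Matrix multiplication: the lower left entry of the product is `m b' + c m'`, where `m b'` is
the right action of `B` on `M` and `c m'` the left action of `C` on `M`. -/
instance : Mul (TriMat B C M) :=
  ⟨fun x y => ⟨x.b * y.b, op y.b • x.m + x.c • y.m, x.c * y.c⟩⟩

@[simp] lemma mul_b (x y : TriMat B C M) : (x * y).b = x.b * y.b := rfl
@[simp] lemma mul_m (x y : TriMat B C M) : (x * y).m = op y.b • x.m + x.c • y.m := rfl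
@[simp] lemma mul_c (x y : TriMat B C M) : (x * y).c = x.c * y.c := rfl

/-- The triangular matrix ring. -/
instance [SMulCommClass C Bᵐᵒᵖ M] : Ring (TriMat B C M) where
  zero_mul x := by ext <;> simp
  mul_zero x := by ext <;> simp
  one_mul x := by ext <;> simp
  mul_one x := by ext <;> simp
  mul_assoc x y z := by
    ext
    · simp [mul_assoc]
    · simp [mul_smul, smul_add, add_assoc, smul_comm]
    · simp [mul_assoc]
  left_distrib x y z := by
    ext
    · simp [mul_add]
    · simp only [mul_m, add_b, add_m, MulOpposite.op_add, add_smul, smul_add]; abel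
    · simp [mul_add]
  right_distrib x y z := by
    ext
    · simp [add_mul]
    · simp only [mul_m, add_c, add_m, add_smul, smul_add]; abel
    · simp [add_mul]
  __ := (inferInstance : AddCommGroup (TriMat B C M))

/-- The triangular matrix ring of `k`-algebras `B`, `C` and a `C`-`B`-bimodule `M` on which `k`
acts centrally is a `k`-algebra, with the entrywise scalar multiplication. -/
instance {k : Type v} [CommRing k] [Algebra k B] [Algebra k C] [Module k M]
    [IsScalarTower k C M] [IsScalarTower k Bᵐᵒᵖ M] [SMulCommClass C Bᵐᵒᵖ M] :
    Algebra k (TriMat B C M) where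
  smul r x := ⟨r • x.b, r • x.m, r • x.c⟩
  algebraMap :=
    { toFun := fun r => ⟨algebraMap k B r, 0, algebraMap k C r⟩
      map_one' := by ext <;> simp
      map_mul' := fun r s => by ext <;> simp
      map_zero' := by ext <;> simp
      map_add' := fun r s => by ext <;> simp }
  commutes' r x := by
    ext
    · exact Algebra.commutes r x.b
    · have h : op (algebraMap k B r) • x.m = r • x.m :=
        algebraMap_smul Bᵐᵒᵖ r x.m
      simp [h]
    · exact Algebra.commutes r x.c
  smul_def' r x := by
    ext
    · exact Algebra.smul_def r x.b
    · change r • x.m = op x.b • (0 : M) + algebraMap k C r • x.m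
      simp
    · exact Algebra.smul_def r x.c

end TriMat

/-- The injective dimension of a left `R`-module, in `{-∞} ∪ ℕ ∪ {∞}`. Right `R`-modules are
treated as left modules over `Rᵐᵒᵖ`. -/
noncomputable abbrev injDim (R M : Type u) [Ring R] [AddCommGroup M] [Module R M] :
    WithBot ℕ∞ :=
  CategoryTheory.injectiveDimension (ModuleCat.of R M)

/-- The projective dimension of a left `R`-module, with the convention that the zero module has
projective dimension `0` (rather than `-∞`). Right `R`-modules are treated as left modules
over `Rᵐᵒᵖ`. -/
noncomputable abbrev projDim (R M : Type u) [Ring R] [AddCommGroup M] [Module R M] :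
    WithBot ℕ∞ :=
  max 0 (CategoryTheory.projectiveDimension (ModuleCat.of R M))

/-!
Over a triangular matrix ring every module is glued from modules over the two diagonal rings, and
the inequalities come from following injective dimensions through the two projections of the ring.

Both the left modules over `A = TriMat B C M` and the right ones fit one pattern, recorded in
`TriangularExtension R S T M`: a ring `R` with projections to `S` and `T`, such that the kernel of
`R → T` is the `S`-module `S × M`. The left modules are the case `(A, C, B)`, the right modules the
case `(Aᵐᵒᵖ, Bᵐᵒᵖ, Cᵐᵒᵖ)`; the two sides of `A` are therefore exchanged by swapping `S` and `T` and
passing to opposite rings.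

*Lower bounds.* `S` is a direct summand of `R` as an `R`-module, so coextension of scalars
`Hom_R(S, -)` is exact. It preserves injectives, hence does not raise injective dimension, and it
sends `R` to an `S`-module having `S` as a direct summand.

*Upper bounds.* The exact sequence `0 → S × M → R → T → 0` bounds the injective dimension of `R` by
those of its outer terms. Over `S`, the module `M` is finitely generated of finite projective
dimension, so its injective dimension is at most that of `S`
(`hasInjectiveDimensionLT_of_finite_of_hasProjectiveDimensionLT`). To pass from `S` to `R` one uses
the change of rings inequality `id_R X ≤ id_S X + pd S`, where on the right `S` is regarded as an
`R`-module from the other side (`hasInjectiveDimensionLT_restrictScalars`). It holds because every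
injective `S`-module is a summand of some `Hom_ℤ(S, V)` with `V` divisible, and `Hom_ℤ(-, V)` turns
projective resolutions into injective ones (`OpDual.hasInjectiveDimensionLT`). Finally, the exact
sequence `0 → T × M → R → S → 0` of modules from the other side shows that `pd S ≤ pd_T M + 1`, and
`T` is projective over `R` on that side, so that the injective dimension of `T` over `R` is at most
that over `T`.
-/

open CategoryTheory

/-! ### Exact functors and homological dimensions -/

section ExactFunctors

universe w₁ w₂ v₁ v₂

variable {C : Type w₁} {D : Type w₂} [Category.{v₁} C] [Category.{v₂} D] [Abelian C] [Abelian D]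

/-- If an exact functor sends injective objects to objects of injective dimension at most `p`, then
it raises injective dimensions by at most `p`. -/
lemma hasInjectiveDimensionLT_obj_of_exact [EnoughInjectives C] (F : C ⥤ D)
    [F.PreservesZeroMorphisms]
    (hF : ∀ s : ShortComplex C, s.ShortExact → (s.map F).ShortExact) (p : ℕ)
    (hI : ∀ I : C, Injective I → HasInjectiveDimensionLT (F.obj I) (p + 1)) (n : ℕ) (X : C)
    (hX : HasInjectiveDimensionLT X n) : HasInjectiveDimensionLT (F.obj X) (n + p) := by
  induction n generalizing X with
  | zero =>
    have := (F.map_isZero (isZero_of_hasInjectiveDimensionLT_zero X)).hasInjectiveDimensionLT_zero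
    exact hasInjectiveDimensionLT_of_ge _ 0 _ (Nat.zero_le _)
  | succ n ih =>
    cases n with
    | zero =>
      have := hI X (injective_iff_hasInjectiveDimensionLT_one.2 hX)
      exact hasInjectiveDimensionLT_of_ge _ (p + 1) _ (by omega)
    | succ n =>
      let s : ShortComplex C := ShortComplex.mk (Injective.ι X) (Limits.cokernel.π (Injective.ι X))
        (by simp)
      have hs : s.ShortExact :=
        { exact := ShortComplex.exact_cokernel _ }
      have h₃ := ih s.X₃ ((hs.hasInjectiveDimensionLT_X₃_iff n
        (Injective.injective_under X)).2 hX)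
      have := hI _ (Injective.injective_under X)
      have h₂ : HasInjectiveDimensionLT (F.obj s.X₂) (n + 1 + p + 1) :=
        hasInjectiveDimensionLT_of_ge (F.obj (Injective.under X)) (p + 1) _ (by omega)
      have h₁ := (hF s hs).hasInjectiveDimensionLT_X₁ (n + 1 + p) h₃ h₂
      have e : n + 1 + 1 + p = n + 1 + p + 1 := by omega
      rw [e]
      exact h₁

lemma hasProjectiveDimensionLT_obj_of_exact [EnoughProjectives C] (F : C ⥤ D)
    [F.PreservesZeroMorphisms]
    (hF : ∀ s : ShortComplex C, s.ShortExact → (s.map F).ShortExact)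
    (hP : ∀ P : C, Projective P → Projective (F.obj P)) (n : ℕ) (X : C)
    (hX : HasProjectiveDimensionLT X n) : HasProjectiveDimensionLT (F.obj X) n := by
  induction n generalizing X with
  | zero =>
    exact (F.map_isZero (isZero_of_hasProjectiveDimensionLT_zero X)).hasProjectiveDimensionLT_zero
  | succ n ih =>
    cases n with
    | zero =>
      exact projective_iff_hasProjectiveDimensionLT_one.1
        (hP X (projective_iff_hasProjectiveDimensionLT_one.2 hX))
    | succ n =>
      let s : ShortComplex C := ShortComplex.mk (Limits.kernel.ι (Projective.π X)) (Projective.π X)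
        (by simp)
      have hs : s.ShortExact :=
        { exact := ShortComplex.exact_kernel _ }
      have hproj : Projective s.X₂ := inferInstanceAs (Projective (Projective.over X))
      have h₁ := ih s.X₁ ((hs.hasProjectiveDimensionLT_X₃_iff n hproj).1 hX)
      exact ((hF s hs).hasProjectiveDimensionLT_X₃_iff n (hP _ hproj)).2 h₁

end ExactFunctors

/-! ### Dimensions of modules over a fixed ring -/

section Modules

variable {R : Type u} [Ring R]

lemma shortExact_of_linearMap {X Y Z : Type u} [AddCommGroup X] [AddCommGroup Y] [AddCommGroup Z]
    [Module R X] [Module R Y] [Module R Z] (f : X →ₗ[R] Y) (g : Y →ₗ[R] Z)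
    (hf : Function.Injective f) (hfg : Function.Exact f g) (hg : Function.Surjective g) :
    (ModuleCat.shortComplexOfCompEqZero f g hfg.linearMap_comp_eq_zero).ShortExact :=
  ModuleCat.shortComplex_shortExact _ hfg hf hg

lemma retract_of_linearMap {X Y : Type u} [AddCommGroup X] [AddCommGroup Y] [Module R X]
    [Module R Y] (f : X →ₗ[R] Y) (g : Y →ₗ[R] X) (h : ∀ x, g (f x) = x) :
    Nonempty (Retract (ModuleCat.of R X) (ModuleCat.of R Y)) :=
  ⟨{ i := ModuleCat.ofHom f
     r := ModuleCat.ofHom g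
     retract := by ext x; exact h x }⟩

lemma hasInjectiveDimensionLT_prod (X Y : Type u) [AddCommGroup X] [AddCommGroup Y] [Module R X]
    [Module R Y] (n : ℕ) (hX : HasInjectiveDimensionLT (ModuleCat.of R X) n)
    (hY : HasInjectiveDimensionLT (ModuleCat.of R Y) n) :
    HasInjectiveDimensionLT (ModuleCat.of R (X × Y)) n :=
  (shortExact_of_linearMap (LinearMap.inl R X Y) (LinearMap.snd R X Y) LinearMap.inl_injective
    Function.Exact.inl_snd LinearMap.snd_surjective).hasInjectiveDimensionLT_X₂ n hX hY

lemma hasProjectiveDimensionLT_prod (X Y : Type u) [AddCommGroup X] [AddCommGroup Y] [Module R X]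
    [Module R Y] (n : ℕ) (hX : HasProjectiveDimensionLT (ModuleCat.of R X) n)
    (hY : HasProjectiveDimensionLT (ModuleCat.of R Y) n) :
    HasProjectiveDimensionLT (ModuleCat.of R (X × Y)) n :=
  (shortExact_of_linearMap (LinearMap.inl R X Y) (LinearMap.snd R X Y) LinearMap.inl_injective
    Function.Exact.inl_snd LinearMap.snd_surjective).hasProjectiveDimensionLT_X₂ n hX hY

lemma hasInjectiveDimensionLT_fin_fun (n : ℕ) (hR : HasInjectiveDimensionLT (ModuleCat.of R R) n)
    (k : ℕ) : HasInjectiveDimensionLT (ModuleCat.of R (Fin k → R)) n := by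
  induction k with
  | zero =>
    have := (ModuleCat.isZero_of_subsingleton
      (ModuleCat.of R (Fin 0 → R))).hasInjectiveDimensionLT_zero
    exact hasInjectiveDimensionLT_of_ge _ 0 _ (Nat.zero_le _)
  | succ k ih =>
    have := hasInjectiveDimensionLT_prod R (Fin k → R) n hR ih
    exact hasInjectiveDimensionLT_of_iso
      (Fin.consLinearEquiv R (fun _ : Fin (k + 1) => R)).toModuleIso n

/-- Over a left noetherian ring, a finitely generated module of finite projective dimension has
injective dimension at most that of the ring: this is inherited along a resolution by finitely
generated free modules. -/
lemma hasInjectiveDimensionLT_of_finite_of_hasProjectiveDimensionLT [IsNoetherianRing R] (m n : ℕ)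
    (hR : HasInjectiveDimensionLT (ModuleCat.of R R) n) (X : Type u) [AddCommGroup X] [Module R X]
    [Module.Finite R X] (hX : HasProjectiveDimensionLT (ModuleCat.of R X) m) :
    HasInjectiveDimensionLT (ModuleCat.of R X) n := by
  induction m generalizing X with
  | zero =>
    have := (isZero_of_hasProjectiveDimensionLT_zero
      (ModuleCat.of R X)).hasInjectiveDimensionLT_zero
    exact hasInjectiveDimensionLT_of_ge _ 0 _ (Nat.zero_le _)
  | succ m ih =>
    obtain ⟨k, f, hf⟩ := Module.Finite.exists_fin' R X
    have hF := hasInjectiveDimensionLT_fin_fun n hR k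
    cases m with
    | zero =>
      have hP : Module.Projective R X := (IsProjective.iff_projective X).2
        (projective_iff_hasProjectiveDimensionLT_one.2 hX)
      obtain ⟨g, hg⟩ := Module.projective_lifting_property f LinearMap.id hf
      obtain ⟨r⟩ := retract_of_linearMap g f (LinearMap.congr_fun hg)
      exact r.hasInjectiveDimensionLT n
    | succ m =>
      have hs := LinearMap.shortExact_shortComplexKer hf
      have hproj : Projective (ModuleCat.of R (Fin k → R)) :=
        (IsProjective.iff_projective _).1 inferInstance
      have hK := ih (LinearMap.ker f) ((hs.hasProjectiveDimensionLT_X₃_iff m hproj).1 hX)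
      exact hs.hasInjectiveDimensionLT_X₃ n hF (hasInjectiveDimensionLT_of_ge _ n _ (by omega))

end Modules

/-! ### Duality between modules over opposite rings -/

section OppositeDual

/-- The group `N →+ V` of additive maps, regarded as an `R`-module when `N` is an `R'`-module: `r`
acts by precomposition with the action of `τ r` on `N`. Recording the ring homomorphism `τ` in the
type, rather than taking `R = R'ᵐᵒᵖ`, keeps iterated opposite rings out of the applications. -/
def OpDual {R R' : Type u} [Ring R] [Ring R'] (_τ : R →+* R'ᵐᵒᵖ) (N V : Type u) [AddCommGroup N]
    [AddCommGroup V] : Type u :=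
  N →+ V

namespace OpDual

variable {R R' : Type u} [Ring R] [Ring R'] (τ : R →+* R'ᵐᵒᵖ) (N V : Type u) [AddCommGroup N]
    [AddCommGroup V]

instance : AddCommGroup (OpDual τ N V) := inferInstanceAs (AddCommGroup (N →+ V))

instance : FunLike (OpDual τ N V) N V := inferInstanceAs (FunLike (N →+ V) N V)

instance : AddMonoidHomClass (OpDual τ N V) N V :=
  inferInstanceAs (AddMonoidHomClass (N →+ V) N V)

variable {τ N V}

@[ext] lemma ext {φ ψ : OpDual τ N V} (h : ∀ x, φ x = ψ x) : φ = ψ := DFunLike.ext _ _ h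

@[simp] lemma add_apply (φ ψ : OpDual τ N V) (x : N) : (φ + ψ) x = φ x + ψ x := rfl

@[simp] lemma zero_apply (x : N) : (0 : OpDual τ N V) x = 0 := rfl

variable [Module R' N]

instance : Module R (OpDual τ N V) where
  smul r φ := (φ : N →+ V).comp (DistribSMul.toAddMonoidHom N (τ r).unop)
  one_smul φ := by
    ext x; change φ ((τ 1).unop • x) = φ x; simp
  mul_smul r s φ := by
    ext x
    change φ ((τ (r * s)).unop • x) = φ ((τ s).unop • (τ r).unop • x)
    simp [mul_smul]
  smul_zero r := by ext x; rfl
  smul_add r φ ψ := by ext x; rfl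
  add_smul r s φ := by
    ext x
    change φ ((τ (r + s)).unop • x) = φ ((τ r).unop • x) + φ ((τ s).unop • x)
    simp [add_smul]
  zero_smul φ := by
    ext x; change φ ((τ 0).unop • x) = 0; simp

@[simp] lemma smul_apply (r : R) (φ : OpDual τ N V) (x : N) :
    (r • φ) x = φ ((τ r).unop • x) := rfl

variable (τ V) in
/-- Precomposition with an `R'`-linear map, as an `R`-linear map. -/
def map {N' : Type u} [AddCommGroup N'] [Module R' N'] (f : N →ₗ[R'] N') :
    OpDual τ N' V →ₗ[R] OpDual τ N V where
  toFun φ := (φ : N' →+ V).comp f.toAddMonoidHom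
  map_add' _ _ := rfl
  map_smul' r φ := by
    ext x; change φ ((τ r).unop • f x) = φ (f ((τ r).unop • x)); simp

@[simp] lemma map_apply {N' : Type u} [AddCommGroup N'] [Module R' N'] (f : N →ₗ[R'] N')
    (φ : OpDual τ N' V) (x : N) : map τ V f φ x = φ (f x) := rfl

/-- Additive maps to an injective abelian group extend. -/
lemma map_surjective [Module.Injective ℤ V] {N' : Type u} [AddCommGroup N'] [Module R' N']
    (f : N →ₗ[R'] N') (hf : Function.Injective f) : Function.Surjective (map τ V f) := by
  intro φ
  obtain ⟨ψ, hψ⟩ := Module.Injective.out (f.toAddMonoidHom.toIntLinearMap) hf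
    (AddMonoidHom.toIntLinearMap (φ : N →+ V))
  exact ⟨(ψ.toAddMonoidHom : N' →+ V), OpDual.ext hψ⟩

/-- An identification of `R` with the opposite of `R'`, read as one of `R'` with the opposite
of `R`. -/
def flip (τ : R ≃+* R'ᵐᵒᵖ) : R' →+* Rᵐᵒᵖ :=
  (RingEquiv.op τ.symm).toRingHom.comp (RingEquiv.opOp R').toRingHom

@[simp] lemma flip_unop (τ : R ≃+* R'ᵐᵒᵖ) (a : R') : (flip τ a).unop = τ.symm (op a) := rfl

/-- The dual of a projective module is injective. By currying, an `R`-linear map from `Y` to the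
dual of `N` is the same as an `R'`-linear map from `N` to the dual of `Y`; so extending the former
along a monomorphism `Y → Z` amounts to lifting the latter along the epimorphism from the dual of
`Z` to the dual of `Y`. -/
lemma injective_of_projective (τ : R ≃+* R'ᵐᵒᵖ) [Module.Injective ℤ V] [Module.Projective R' N] :
    Module.Injective R (OpDual τ.toRingHom N V) where
  out Y Z _ _ _ _ i hi g := by
    let g' : N →ₗ[R'] OpDual (flip τ) Y V :=
      { toFun := fun x => ({ toFun := fun y => g y x, map_zero' := by rw [map_zero g]; rfl,
                             map_add' := fun y y' => by rw [map_add g]; rfl } : Y →+ V)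
        map_add' := fun x x' => by ext y; exact map_add (g y) x x'
        map_smul' := fun a x => by
          ext y
          change g y (a • x) = g (τ.symm (op a) • y) x
          rw [map_smul g, smul_apply]
          simp }
    obtain ⟨h, hh⟩ := Module.projective_lifting_property (map (flip τ) V i) g'
      (map_surjective i hi)
    refine ⟨{ toFun := fun z => ({ toFun := fun x => h x z, map_zero' := by simp,
                                   map_add' := by simp } : N →+ V)
              map_add' := fun z z' => by ext x; exact map_add (h x) z z'
              map_smul' := fun r z => by
                ext x
                change h x (r • z) = h ((τ r).unop • x) z
                simp }, fun y => ?_⟩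
    ext x
    exact DFunLike.congr_fun (LinearMap.congr_fun hh x) y

/-- The injective dimension of the dual of `N` is at most the projective dimension of `N`. -/
lemma hasInjectiveDimensionLT (τ : R ≃+* R'ᵐᵒᵖ) (V : Type u) [AddCommGroup V]
    [Module.Injective ℤ V] (n : ℕ)
    (N : Type u) [AddCommGroup N] [Module R' N]
    (hN : HasProjectiveDimensionLT (ModuleCat.of R' N) n) :
    HasInjectiveDimensionLT (ModuleCat.of R (OpDual τ.toRingHom N V)) n := by
  induction n generalizing N with
  | zero =>
    have : Subsingleton N :=
      ModuleCat.subsingleton_of_isZero (isZero_of_hasProjectiveDimensionLT_zero (ModuleCat.of R' N))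
    have : Subsingleton (OpDual τ.toRingHom N V) :=
      ⟨fun φ ψ => OpDual.ext fun x => by rw [Subsingleton.elim x 0, map_zero, map_zero]⟩
    exact (ModuleCat.isZero_of_subsingleton _).hasInjectiveDimensionLT_zero
  | succ n ih =>
    cases n with
    | zero =>
      have : Module.Projective R' N := (IsProjective.iff_projective N).2
        (projective_iff_hasProjectiveDimensionLT_one.2 hN)
      exact injective_iff_hasInjectiveDimensionLT_one.1
        ((Module.injective_iff_injective_object _ _).1 (injective_of_projective τ))
    | succ n =>
      let f : (N →₀ R') →ₗ[R'] N := Finsupp.linearCombination R' id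
      have hf : Function.Surjective f := Finsupp.linearCombination_id_surjective R' N
      have hs := LinearMap.shortExact_shortComplexKer hf
      have hproj : Projective (ModuleCat.of R' (N →₀ R')) :=
        (IsProjective.iff_projective _).1 inferInstance
      have hK := ih (LinearMap.ker f) ((hs.hasProjectiveDimensionLT_X₃_iff n hproj).1 hN)
      have hex : Function.Exact (map τ.toRingHom V f)
          (map (N := LinearMap.ker f) τ.toRingHom V (LinearMap.ker f).subtype) := by
        intro φ
        constructor
        · intro h
          let φ' : (N →₀ R') →+ V := φ
          have hφ : f.toAddMonoidHom.ker ≤ φ'.ker := fun x hx =>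
            AddMonoidHom.mem_ker.2 (DFunLike.congr_fun h (⟨x, hx⟩ : LinearMap.ker f))
          refine ⟨(f.toAddMonoidHom.liftOfSurjective hf ⟨φ', hφ⟩ : N →+ V), ?_⟩
          ext x
          exact AddMonoidHom.liftOfRightInverse_comp_apply f.toAddMonoidHom _
            (Function.rightInverse_surjInv hf) ⟨φ', hφ⟩ x
        · rintro ⟨ψ, rfl⟩
          ext x
          change ψ (f x) = 0
          rw [LinearMap.mem_ker.1 x.2, map_zero]
      have hd := shortExact_of_linearMap _ _
        (fun φ ψ h => OpDual.ext fun x => by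
          obtain ⟨y, rfl⟩ := hf x
          exact DFunLike.congr_fun h y) hex (map_surjective _ (Submodule.injective_subtype _))
      exact (hd.hasInjectiveDimensionLT_X₃_iff n ((Module.injective_iff_injective_object _ _).1
        (injective_of_projective τ))).1 hK

end OpDual

end OppositeDual

/-! ### Change of rings -/

section ChangeOfRings

variable {R S : Type u} [Ring R] [Ring S] (f : R →+* S)

lemma restrictScalars_shortExact (s : ShortComplex (ModuleCat.{u} S)) (hs : s.ShortExact) :
    (s.map (ModuleCat.restrictScalars.{u} f)).ShortExact :=
  ModuleCat.shortComplex_shortExact _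
    ((ShortComplex.ShortExact.moduleCat_exact_iff_function_exact s).1 hs.exact)
    hs.moduleCat_injective_f hs.moduleCat_surjective_g

lemma coextendScalars_preservesEpimorphisms
    (hS : Projective ((ModuleCat.restrictScalars.{u} f).obj (ModuleCat.of S S))) :
    (ModuleCat.coextendScalars.{u, u, u} f).PreservesEpimorphisms where
  preserves {X Y} g hg := by
    rw [ModuleCat.epi_iff_surjective] at hg ⊢
    have : Module.Projective R ((ModuleCat.restrictScalars.{u} f).obj (ModuleCat.of S S)) :=
      (IsProjective.iff_projective _).2 hS
    intro φ
    obtain ⟨ψ, hψ⟩ := Module.projective_lifting_property g.hom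
      (ModuleCat.CoextendScalars.equiv f Y φ) hg
    exact ⟨(ModuleCat.CoextendScalars.equiv f X).symm ψ, ModuleCat.CoextendScalars.ext hψ⟩

lemma coextendScalars_shortExact
    (hS : Projective ((ModuleCat.restrictScalars.{u} f).obj (ModuleCat.of S S)))
    (s : ShortComplex (ModuleCat.{u} R)) (hs : s.ShortExact) :
    (s.map (ModuleCat.coextendScalars.{u, u, u} f)).ShortExact := by
  have : (ModuleCat.coextendScalars.{u, u, u} f).IsRightAdjoint :=
    (ModuleCat.restrictCoextendScalarsAdj.{u, u, u} f).isRightAdjoint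
  have : (ModuleCat.coextendScalars.{u, u, u} f).Additive :=
    (ModuleCat.restrictCoextendScalarsAdj.{u, u, u} f).right_adjoint_additive
  have hlim : Limits.PreservesFiniteLimits (ModuleCat.coextendScalars.{u, u, u} f) := inferInstance
  have key := (Functor.preservesFiniteLimits_tfae (ModuleCat.coextendScalars.{u, u, u} f)).out 3 0
  obtain ⟨h₁, h₂⟩ := key.1 hlim s hs
  have := coextendScalars_preservesEpimorphisms f hS
  have := hs.epi_g
  exact
    { exact := h₁
      mono_f := h₂
      epi_g := inferInstanceAs (Epi ((ModuleCat.coextendScalars.{u, u, u} f).map s.g)) }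

lemma hasProjectiveDimensionLT_restrictScalars
    (hS : Projective ((ModuleCat.restrictScalars.{u} f).obj (ModuleCat.of S S))) (n : ℕ)
    (X : ModuleCat.{u} S) (hX : HasProjectiveDimensionLT X n) :
    HasProjectiveDimensionLT ((ModuleCat.restrictScalars.{u} f).obj X) n := by
  have := coextendScalars_preservesEpimorphisms f hS
  exact hasProjectiveDimensionLT_obj_of_exact _ (restrictScalars_shortExact f)
    (fun P hP => (ModuleCat.restrictCoextendScalarsAdj.{u, u, u} f).map_projective P hP) n X hX

lemma hasInjectiveDimensionLT_coextendScalars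
    (hS : Projective ((ModuleCat.restrictScalars.{u} f).obj (ModuleCat.of S S))) (n : ℕ)
    (X : ModuleCat.{u} R) (hX : HasInjectiveDimensionLT X n) :
    HasInjectiveDimensionLT ((ModuleCat.coextendScalars.{u, u, u} f).obj X) n := by
  have : (ModuleCat.restrictScalars.{u} f).PreservesMonomorphisms :=
    ⟨fun g hg => by rw [ModuleCat.mono_iff_injective] at hg ⊢; exact hg⟩
  have : (ModuleCat.coextendScalars.{u, u, u} f).Additive :=
    (ModuleCat.restrictCoextendScalarsAdj.{u, u, u} f).right_adjoint_additive
  exact hasInjectiveDimensionLT_obj_of_exact _ (coextendScalars_shortExact f hS) 0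
    (fun I hI => injective_iff_hasInjectiveDimensionLT_one.1
      ((ModuleCat.restrictCoextendScalarsAdj.{u, u, u} f).map_injective I hI)) n X hX

lemma exists_injective_int_module_embedding (X : Type u) [AddCommGroup X] :
    ∃ (V : Type u) (_ : AddCommGroup V) (_ : Module.Injective ℤ V) (j : X →+ V),
      Function.Injective j := by
  let I : ModuleCat.{u} ℤ := Injective.under (ModuleCat.of ℤ X)
  let ι : ModuleCat.of ℤ X ⟶ I := Injective.ι (ModuleCat.of ℤ X)
  have hι : Function.Injective ι := (ModuleCat.mono_iff_injective ι).1 inferInstance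
  have hI : Injective (ModuleCat.of ℤ I) := Injective.injective_under (ModuleCat.of ℤ X)
  have hI' := Module.injective_module_of_injective_object ℤ I
  refine ⟨I, inferInstance, ?_, ι.hom.toAddMonoidHom, hι⟩
  convert hI'
  exact Subsingleton.elim _ _

variable {R' S' : Type u} [Ring R'] [Ring S'] (τ : R ≃+* R'ᵐᵒᵖ) (σ : S ≃+* S'ᵐᵒᵖ) (f' : R' →+* S')

/-- The change of rings inequality for injective dimension. Here `f'` is the homomorphism opposite
to `f`, so that the hypothesis on `S'` concerns `S` as an `R`-module from the other side. -/
lemma hasInjectiveDimensionLT_restrictScalars (hf : ∀ r, (σ (f r)).unop = f' (τ r).unop) (p : ℕ)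
    (hS' : HasProjectiveDimensionLT
      ((ModuleCat.restrictScalars.{u} f').obj (ModuleCat.of S' S')) (p + 1))
    (n : ℕ) (X : ModuleCat.{u} S) (hX : HasInjectiveDimensionLT X n) :
    HasInjectiveDimensionLT ((ModuleCat.restrictScalars.{u} f).obj X) (n + p) := by
  refine hasInjectiveDimensionLT_obj_of_exact _ (restrictScalars_shortExact f) p
    (fun I hI => ?_) n X hX
  -- An injective `I` is a summand of the coinduced module of additive maps from `S'` to `V`, which
  -- over `R` is still the dual of an `R'`-module.
  obtain ⟨V, _, _, j, hj⟩ := exists_injective_int_module_embedding I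
  let e : I →ₗ[S] OpDual σ.toRingHom S' V :=
    { toFun := fun x => (({ toFun := fun a => j (σ.symm (op a) • x), map_zero' := by simp,
                            map_add' := fun a b => by simp [add_smul] } : S' →+ V))
      map_add' := fun x y => by
        ext a; change j (σ.symm (op a) • (x + y)) = j (σ.symm (op a) • x) + j (σ.symm (op a) • y)
        simp
      map_smul' := fun s x => by
        ext a
        change j (σ.symm (op a) • s • x) = j (σ.symm (op ((σ s).unop * a)) • x)
        rw [MulOpposite.op_mul, map_mul, mul_smul, MulOpposite.op_unop,
          RingEquiv.symm_apply_apply] }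
  have he : Function.Injective e := fun x y h => hj (by
    have := DFunLike.congr_fun h (1 : S')
    change j (σ.symm (op 1) • x) = j (σ.symm (op 1) • y) at this
    simpa using this)
  have : Mono (ModuleCat.ofHom e) := (ModuleCat.mono_iff_injective _).2 he
  let ret : Retract I (ModuleCat.of S (OpDual σ.toRingHom S' V)) :=
    { i := ModuleCat.ofHom e
      r := Injective.factorThru (𝟙 I) (ModuleCat.ofHom e) }
  have hd := OpDual.hasInjectiveDimensionLT τ V (p + 1)
    ((ModuleCat.restrictScalars.{u} f').obj (ModuleCat.of S' S')) hS'
  let iso : (ModuleCat.restrictScalars.{u} f).obj (ModuleCat.of S (OpDual σ.toRingHom S' V)) ≅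
      ModuleCat.of R (OpDual τ.toRingHom
        ((ModuleCat.restrictScalars.{u} f').obj (ModuleCat.of S' S')) V) :=
    LinearEquiv.toModuleIso (R := R)
      (X₁ := ((ModuleCat.restrictScalars.{u} f).obj (ModuleCat.of S (OpDual σ.toRingHom S' V)) :
        ModuleCat.{u} R))
      (g₁ := ModuleCat.isAddCommGroup _) (m₁ := ModuleCat.isModule _)
      { toFun := fun φ => φ
        invFun := fun φ => φ
        map_add' := fun _ _ => rfl
        left_inv := fun _ => rfl
        right_inv := fun _ => rfl
        map_smul' := fun r φ => by
          refine OpDual.ext fun (a : S') => ?_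
          change (show S' →+ V from φ) ((σ (f r)).unop * a) =
            (show S' →+ V from φ) (f' (τ r).unop * a)
          rw [hf] }
  have := hasInjectiveDimensionLT_of_iso iso.symm (p + 1)
  exact (ret.map (ModuleCat.restrictScalars.{u} f)).hasInjectiveDimensionLT (p + 1)

end ChangeOfRings

/-! ### Triangular extensions of rings -/

lemma exists_nat_of_add_lt {d e : WithBot ℕ∞} {n : ℕ} (hd : d ≠ ⊥) (he : 0 ≤ e)
    (h : d + e + 1 < n) : ∃ m q : ℕ, d = m ∧ e = q ∧ m + q + 1 < n := by
  induction d with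
  | bot => exact absurd rfl hd
  | coe d =>
    induction e with
    | bot => simp at he
    | coe e =>
      have h' : d + e + 1 < (n : ℕ∞) := by exact_mod_cast h
      induction d with
      | top => simp at h'
      | coe d =>
        induction e with
        | top => simp at h'
        | coe e => exact ⟨d, e, rfl, rfl, by exact_mod_cast h'⟩

/-- A presentation of `R` as a triangular extension, seen through its left modules: `R` projects
onto rings `S` and `T`, the kernel of the projection to `T` is the `S`-module `S × M` (with `R`
acting through `S`), and on the summand `S` of that kernel the projection to `S` is the identity.
Nothing is required of the action of `T` on `M` from the other side; it enters only through the
triangular extension of the opposite ring. -/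
structure TriangularExtension (R S T M : Type u) [Ring R] [Ring S] [Ring T] [AddCommGroup M]
    [Module S M] where
  /-- The projection to the diagonal ring whose modules include the kernel of `snd`. -/
  fst : R →+* S
  /-- The projection to the other diagonal ring. -/
  snd : R →+* T
  /-- The inclusion of the kernel of `snd`. -/
  incl : S × M →+ R
  incl_smul : ∀ (r : R) (x : S × M), incl (fst r • x) = r * incl x
  incl_injective : Function.Injective incl
  exact : Function.Exact incl snd
  snd_surjective : Function.Surjective snd
  fst_incl : ∀ s : S, fst (incl (s, 0)) = s

namespace TriangularExtension

section

variable {R S T M : Type u} [Ring R] [Ring S] [Ring T] [AddCommGroup M] [Module S M]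
  (E : TriangularExtension R S T M)

/-- The inclusion of the kernel of the second projection, as an `R`-linear map. -/
noncomputable def inclHom :
    (ModuleCat.restrictScalars.{u} E.fst).obj (ModuleCat.of S (S × M)) →ₗ[R] R where
  toFun x := E.incl x
  map_add' := E.incl.map_add
  map_smul' := E.incl_smul

/-- The second projection, as an `R`-linear map. -/
noncomputable def sndHom :
    R →ₗ[R] (ModuleCat.restrictScalars.{u} E.snd).obj (ModuleCat.of T T) where
  toFun r := E.snd r
  map_add' := E.snd.map_add
  map_smul' := E.snd.map_mul

lemma shortExact_inclHom_sndHom :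
    (ModuleCat.shortComplexOfCompEqZero E.inclHom E.sndHom
      (Function.Exact.linearMap_comp_eq_zero E.exact)).ShortExact :=
  shortExact_of_linearMap E.inclHom E.sndHom E.incl_injective E.exact E.snd_surjective

/-- The inclusion of the first diagonal ring as a left ideal. -/
noncomputable def inclLeft :
    (ModuleCat.restrictScalars.{u} E.fst).obj (ModuleCat.of S S) ⟶ ModuleCat.of R R :=
  ModuleCat.ofHom (X := (ModuleCat.restrictScalars.{u} E.fst).obj (ModuleCat.of S S))
    { toFun := fun s : S => E.incl (s, 0)
      map_add' := fun (s t : S) => by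
        rw [← map_add]
        exact congrArg E.incl (by simp; rfl)
      map_smul' := fun r (s : S) => by
        refine Eq.trans (congrArg E.incl ?_) (E.incl_smul r (s, 0))
        simp; rfl }

lemma projective_restrictScalars_fst :
    Projective ((ModuleCat.restrictScalars.{u} E.fst).obj (ModuleCat.of S S)) := by
  let P : ModuleCat.{u} R := (ModuleCat.restrictScalars.{u} E.fst).obj (ModuleCat.of S S)
  let g : R →ₗ[R] P :=
    { toFun := fun r => E.fst r
      map_add' := E.fst.map_add
      map_smul' := E.fst.map_mul }
  exact (IsProjective.iff_projective (R := R) P).1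
    (Module.Projective.of_split E.inclLeft.hom g (LinearMap.ext E.fst_incl))

/-- `S` is a direct summand of the coextension of scalars of `R` from `R` to `S`. -/
lemma hasInjectiveDimensionLT_fst (E : TriangularExtension R S T M) (n : ℕ)
    (hR : HasInjectiveDimensionLT (ModuleCat.of R R) n) :
    HasInjectiveDimensionLT (ModuleCat.of S S) n := by
  let F := ModuleCat.coextendScalars.{u, u, u} E.fst
  have := hasInjectiveDimensionLT_coextendScalars E.fst E.projective_restrictScalars_fst n _ hR
  let g : F.obj (ModuleCat.of R R) →ₗ[S] S :=
    { toFun := fun φ => E.fst (ModuleCat.CoextendScalars.equiv E.fst _ φ (1 : S))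
      map_add' := fun φ ψ => E.fst.map_add _ _
      map_smul' := fun s φ => by
        let φ' := ModuleCat.CoextendScalars.equiv E.fst _ φ
        have h : φ' s = E.incl (s, 0) * φ' (1 : S) := by
          refine Eq.trans (congrArg φ' ?_) (φ'.map_smul (E.incl (s, 0)) (1 : S))
          change s = E.fst (E.incl (s, 0)) * 1
          rw [E.fst_incl, mul_one]
        change E.fst (φ' ((1 : S) * s : S)) = s * E.fst (φ' (1 : S))
        rw [one_mul, h, map_mul, E.fst_incl] }
  let i : ModuleCat.of S S ⟶ F.obj (ModuleCat.of R R) :=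
    ModuleCat.RestrictionCoextensionAdj.HomEquiv.fromRestriction E.fst E.inclLeft
  have ret : Retract (ModuleCat.of S S) (F.obj (ModuleCat.of R R)) :=
    { i := i
      r := ModuleCat.ofHom g
      retract := by
        refine ModuleCat.hom_ext (LinearMap.ext_ring ?_)
        change E.fst (E.incl ((1 : S) • (1 : S), 0)) = 1
        rw [E.fst_incl, smul_eq_mul, one_mul] }
  exact ret.hasInjectiveDimensionLT n

end

variable {R S T M R' S' T' : Type u} [Ring R] [Ring S] [Ring T] [Ring R'] [Ring S'] [Ring T']
  [AddCommGroup M] [Module S M] [Module T' M]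
  (E : TriangularExtension R S T M) (E' : TriangularExtension R' T' S' M)
  (τ : R ≃+* R'ᵐᵒᵖ) (σ : S ≃+* S'ᵐᵒᵖ) (ρ : T ≃+* T'ᵐᵒᵖ)

/-- As an `R`-module `T` has projective dimension at most `pd_S M + 1`, by the exact sequence
`0 → S × M → R → T → 0`. -/
lemma hasProjectiveDimensionLT_restrictScalars_snd (q : ℕ)
    (hM : HasProjectiveDimensionLT (ModuleCat.of S M) (q + 1)) :
    HasProjectiveDimensionLT ((ModuleCat.restrictScalars.{u} E.snd).obj (ModuleCat.of T T))
      (q + 2) := by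
  have hS : HasProjectiveDimensionLT (ModuleCat.of S S) 1 :=
    projective_iff_hasProjectiveDimensionLT_one.1 ((IsProjective.iff_projective S).1 inferInstance)
  have hR : HasProjectiveDimensionLT (ModuleCat.of R R) 1 :=
    projective_iff_hasProjectiveDimensionLT_one.1 ((IsProjective.iff_projective R).1 inferInstance)
  have := hasProjectiveDimensionLT_restrictScalars E.fst E.projective_restrictScalars_fst (q + 1) _
    (hasProjectiveDimensionLT_prod S M (q + 1)
      (hasProjectiveDimensionLT_of_ge _ 1 _ (by omega)) hM)
  exact E.shortExact_inclHom_sndHom.hasProjectiveDimensionLT_X₃ (q + 1) this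
    (hasProjectiveDimensionLT_of_ge _ 1 _ (by omega))

/-- The upper bound in terms of natural numbers. The case `m = 0` is separate because there `S` and
`M` vanish, so that `q` plays no role. -/
lemma hasInjectiveDimensionLT_self
    (hσ : ∀ r, (σ (E.fst r)).unop = E'.snd (τ r).unop)
    (hρ : ∀ r, (ρ (E.snd r)).unop = E'.fst (τ r).unop) (m q n : ℕ)
    (hS : HasInjectiveDimensionLT (ModuleCat.of S S) m)
    (hSM : HasInjectiveDimensionLT (ModuleCat.of S M) m)
    (hM : HasProjectiveDimensionLT (ModuleCat.of T' M) (q + 1))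
    (hT : HasInjectiveDimensionLT (ModuleCat.of T T) n) (hn : m = 0 ∨ m + (q + 1) ≤ n) :
    HasInjectiveDimensionLT (ModuleCat.of R R) n := by
  have hX := hasInjectiveDimensionLT_prod S M m hS hSM
  have h₁ : HasInjectiveDimensionLT
      ((ModuleCat.restrictScalars.{u} E.fst).obj (ModuleCat.of S (S × M))) n := by
    rcases hn with rfl | hn
    · have := (Functor.map_isZero (ModuleCat.restrictScalars.{u} E.fst)
        (isZero_of_hasInjectiveDimensionLT_zero
          (ModuleCat.of S (S × M)))).hasInjectiveDimensionLT_zero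
      exact hasInjectiveDimensionLT_of_ge _ 0 n (Nat.zero_le n)
    · have := hasInjectiveDimensionLT_restrictScalars E.fst τ σ E'.snd hσ (q + 1)
        (E'.hasProjectiveDimensionLT_restrictScalars_snd q hM) m _ hX
      exact hasInjectiveDimensionLT_of_ge _ _ n hn
  have h₃ : HasInjectiveDimensionLT
      ((ModuleCat.restrictScalars.{u} E.snd).obj (ModuleCat.of T T)) n :=
    hasInjectiveDimensionLT_restrictScalars E.snd τ ρ E'.fst hρ 0
      (projective_iff_hasProjectiveDimensionLT_one.1 E'.projective_restrictScalars_fst) n _ hT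
  exact E.shortExact_inclHom_sndHom.hasInjectiveDimensionLT_X₂ n h₁ h₃

lemma injectiveDimension_fst_le (E : TriangularExtension R S T M) :
    injectiveDimension (ModuleCat.of S S) ≤ injectiveDimension (ModuleCat.of R R) :=
  sInf_le fun n hn =>
    E.hasInjectiveDimensionLT_fst n (injectiveDimension_lt_iff.1 hn)

/-- The upper bound for the injective dimension of a triangular extension `R` over itself. The
extension `E'` presents the opposite ring `R'` of `R`, with the roles of the diagonal rings
exchanged. -/
theorem injectiveDimension_self_le [IsNoetherianRing S] [Module.Finite S M]
    (hσ : ∀ r, (σ (E.fst r)).unop = E'.snd (τ r).unop)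
    (hρ : ∀ r, (ρ (E.snd r)).unop = E'.fst (τ r).unop)
    (hM : max 0 (projectiveDimension (ModuleCat.of S M)) < ⊤) :
    injectiveDimension (ModuleCat.of R R) ≤
      max (injectiveDimension (ModuleCat.of S S) +
        max 0 (projectiveDimension (ModuleCat.of T' M)) + 1)
        (injectiveDimension (ModuleCat.of T T)) := by
  obtain ⟨l, hl⟩ := (projectiveDimension_ne_top_iff (ModuleCat.of S M)).1
    ((le_max_right _ _).trans_lt hM).ne
  refine sInf_le fun n hn => ?_
  obtain ⟨hST, hT⟩ := max_lt_iff.1 hn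
  have hSM (m : ℕ) (hS : HasInjectiveDimensionLT (ModuleCat.of S S) m) :
      HasInjectiveDimensionLT (ModuleCat.of S M) m :=
    hasInjectiveDimensionLT_of_finite_of_hasProjectiveDimensionLT _ _ hS M hl
  obtain ⟨m, q, hS, hM', hmn⟩ : ∃ m q : ℕ, HasInjectiveDimensionLT (ModuleCat.of S S) m ∧
      HasProjectiveDimensionLT (ModuleCat.of T' M) (q + 1) ∧ (m = 0 ∨ m + (q + 1) ≤ n) := by
    -- For `S = 0` the injective dimension is `-∞`, and the bound does not control `pd M`.
    by_cases hbot : injectiveDimension (ModuleCat.of S S) = ⊥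
    · have hS := (injectiveDimension_eq_bot_iff _).1 hbot
      have : Subsingleton S := ModuleCat.subsingleton_of_isZero hS
      have : Subsingleton M := Module.subsingleton S M
      have := (ModuleCat.isZero_of_subsingleton (ModuleCat.of T' M)).hasProjectiveDimensionLT_zero
      exact ⟨0, 0, hS.hasInjectiveDimensionLT_zero, hasProjectiveDimensionLT_of_ge _ 0 _ (by omega),
        Or.inl rfl⟩
    · obtain ⟨m, q, hm, hq, h⟩ := exists_nat_of_add_lt hbot (le_max_left _ _) hST
      refine ⟨m + 1, q, (injectiveDimension_le_iff _ m).1 hm.le,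
        (projectiveDimension_le_iff _ q).1 ((le_max_right _ _).trans hq.le), Or.inr (by omega)⟩
  exact E.hasInjectiveDimensionLT_self E' τ σ ρ hσ hρ m q n hS (hSM m hS) hM'
    (injectiveDimension_lt_iff.1 hT) hmn

end TriangularExtension

/-! ### Triangular matrix rings -/

/-- Over `Aᵐᵒᵖ`, the right module `A` and the ring `Aᵐᵒᵖ` are isomorphic modules. -/
lemma injDim_mulOpposite_self (A : Type u) [Ring A] :
    injDim Aᵐᵒᵖ A = injDim Aᵐᵒᵖ Aᵐᵒᵖ :=
  injectiveDimension_eq_of_iso (LinearEquiv.toModuleIso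
    { MulOpposite.opAddEquiv with map_smul' := fun _ _ => rfl })

namespace TriMat

variable (B C M : Type u) [Ring B] [Ring C] [AddCommGroup M] [Module C M] [Module Bᵐᵒᵖ M]
  [SMulCommClass C Bᵐᵒᵖ M]

/-- The projection of the triangular matrix ring to its upper left corner. -/
@[simps] def bHom : TriMat B C M →+* B where
  toFun := b
  map_one' := rfl
  map_mul' _ _ := rfl
  map_zero' := rfl
  map_add' _ _ := rfl

/-- The projection of the triangular matrix ring to its lower right corner. -/
@[simps] def cHom : TriMat B C M →+* C where
  toFun := c
  map_one' := rfl
  map_mul' _ _ := rfl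
  map_zero' := rfl
  map_add' _ _ := rfl

/-- The triangular matrix ring through its left modules: the matrices with first row zero form the
left `C`-module `C × M`. -/
def leftExtension : TriangularExtension (TriMat B C M) C B M where
  fst := cHom B C M
  snd := bHom B C M
  incl :=
    { toFun := fun x => ⟨0, x.2, x.1⟩
      map_zero' := rfl
      map_add' := fun x y => by ext <;> simp }
  incl_smul r x := by ext <;> simp
  incl_injective x y h := Prod.ext (congrArg c h) (congrArg m h)
  exact r := by
    refine ⟨fun h => ⟨(r.c, r.m), TriMat.ext h.symm rfl rfl⟩, ?_⟩
    rintro ⟨x, rfl⟩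
    rfl
  snd_surjective s := ⟨⟨s, 0, 0⟩, rfl⟩
  fst_incl _ := rfl

/-- The triangular matrix ring through its right modules: the matrices with second diagonal entry
zero form the right `B`-module `B × M`. -/
def rightExtension : TriangularExtension (TriMat B C M)ᵐᵒᵖ Bᵐᵒᵖ Cᵐᵒᵖ M where
  fst := (bHom B C M).op
  snd := (cHom B C M).op
  incl :=
    { toFun := fun x => op ⟨x.1.unop, x.2, 0⟩
      map_zero' := rfl
      map_add' := fun x y => MulOpposite.unop_injective (by ext <;> simp) }
  incl_smul r x := MulOpposite.unop_injective (by ext <;> simp)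
  incl_injective x y h := by
    have h := MulOpposite.op_injective h
    exact Prod.ext (MulOpposite.unop_injective (congrArg b h)) (congrArg m h)
  exact r := by
    refine ⟨fun h => ⟨(op r.unop.b, r.unop.m), MulOpposite.unop_injective
      (TriMat.ext rfl rfl (MulOpposite.op_injective h).symm)⟩, ?_⟩
    rintro ⟨x, rfl⟩
    rfl
  snd_surjective s := ⟨op ⟨0, 0, s.unop⟩, rfl⟩
  fst_incl _ := rfl

end TriMat

theorem corollary2 {k : Type v} [Field k] [IsAlgClosed k]
    (B C M : Type u) [Ring B] [Algebra k B] [Module.Finite k B]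
    [Ring C] [Algebra k C] [Module.Finite k C]
    [AddCommGroup M] [Module k M] [Module C M] [Module Bᵐᵒᵖ M]
    [IsScalarTower k C M] [IsScalarTower k Bᵐᵒᵖ M] [SMulCommClass C Bᵐᵒᵖ M]
    [Module.Finite k M] :
    (injDim Bᵐᵒᵖ B ≤ injDim (TriMat B C M)ᵐᵒᵖ (TriMat B C M) ∧
      injDim C C ≤ injDim (TriMat B C M) (TriMat B C M)) ∧
    (projDim Bᵐᵒᵖ M < ⊤ →
      injDim (TriMat B C M)ᵐᵒᵖ (TriMat B C M) ≤
        max (injDim Bᵐᵒᵖ B + projDim C M + 1) (injDim Cᵐᵒᵖ C)) ∧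
    (projDim C M < ⊤ →
      injDim (TriMat B C M) (TriMat B C M) ≤
        max (injDim C C + projDim Bᵐᵒᵖ M + 1) (injDim B B)) := by
  simp only [injDim_mulOpposite_self]
  have : IsNoetherianRing C := IsNoetherianRing.of_finite k C
  have : IsNoetherianRing Bᵐᵒᵖ := IsNoetherianRing.of_finite k Bᵐᵒᵖ
  have : Module.Finite C M := Module.Finite.of_restrictScalars_finite k C M
  have : Module.Finite Bᵐᵒᵖ M := Module.Finite.of_restrictScalars_finite k Bᵐᵒᵖ M
  exact ⟨⟨(TriMat.rightExtension B C M).injectiveDimension_fst_le,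
      (TriMat.leftExtension B C M).injectiveDimension_fst_le⟩,
    (TriMat.rightExtension B C M).injectiveDimension_self_le (TriMat.leftExtension B C M)
      (RingEquiv.refl _) (RingEquiv.refl _) (RingEquiv.refl _) (fun _ => rfl) (fun _ => rfl),
    (TriMat.leftExtension B C M).injectiveDimension_self_le (TriMat.rightExtension B C M)
      (RingEquiv.opOp _) (RingEquiv.opOp _) (RingEquiv.opOp _) (fun _ => rfl) (fun _ => rfl)⟩
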